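/- Let $G$ be a group and $g \in G$. For $x \in [G,G]$ let $\mathrm{cl}(x)$ be the least number of commutators whose product is $x$, and put $\mathrm{cl}(x)=\infty$ if $x \notin [G,G]$. The stable commutator length of $g$ is $\mathrm{scl}(g) = \liminf_{n\to\infty} \mathrm{cl}(g^n)/n \in [0,\infty]$; this is $\lim_{n\to\infty} \mathrm{cl}(g^n)/n$ if $g\in[G,G]$, it is $\mathrm{scl}(g^k)/k$ if $g^k\in [G,G]$ with $k\ge 1$, and it is $\infty$ if no positive power of $g$ lies in $[G,G]$. For an action of $G$ by isometries on a simplicial tree (with edges of length one) or an $\mathbb{R}$-tree $T$ (a geodesic $0$-hyperbolic metric space), the translation length of $g$ is $|g| = \inf_{x\in T} d(x,gx)$, and $T_g$ is the set of points $x$ with $d(x,gx)=|g|$. The element $g$ is hyperbolic if $|g|>0$, and then $T_g$ is called its axis. (1) Suppose that $G$ acts by automorphisms and without inversions on a simplicial tree $T$ and that $g$ is well-aligned, that is, $g$ is hyperbolic and there is no $h \in G$ such that $ghgh^{-1}$ fixes an edge of the axis $T_g$. Then $\mathrm{scl}(g) \geq 1/12$. (2) Suppose that $G$ acts by isometries on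 an $\mathbb{R}$-tree $T$ and that $g$ is well-aligned, that is, $g$ is hyperbolic and there is no $h\in G$ such that $ghgh^{-1}$ fixes pointwise a nondegenerate segment of the axis $T_g$. Then $\mathrm{scl}(g)\geq 1/12$. -/

import Mathlib

open Filter Set
open scoped ENNReal

/-! ### Commutator length and stable commutator length -/

section StableCommutatorLength

variable {G : Type*} [Group G]

/-- The commutator length of `g`: the least number of commutators `⁅a, b⁆ = a * b * a⁻¹ * b⁻¹`
whose product is `g`, and `⊤` if `g` is not in the commutator subgroup. -/
noncomputable def commutatorLength (g : G) : ℕ∞ :=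
  sInf {n : ℕ∞ | ∃ l : List G, (∀ x ∈ l, x ∈ commutatorSet G) ∧ l.prod = g ∧ (l.length : ℕ∞) = n}

/-- The stable commutator length of `g`, as the lower limit of `cl (g ^ n) / n` in `[0, ∞]`.
If `g` is in the commutator subgroup, then `n ↦ cl (g ^ n)` is finite and subadditive and this is
the limit of `cl (g ^ n) / n`. If only some positive power of `g` is in the commutator subgroup,
this is the limit along those `n` for which `g ^ n` is in it (all other terms are `∞`), that is,
`scl (g ^ k) / k` for every `k ≥ 1` with `g ^ k` in the commutator subgroup.
If no positive power of `g` is in the commutator subgroup, it is `∞`. -/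
noncomputable def scl (g : G) : ℝ≥0∞ :=
  liminf (fun n : ℕ => ((commutatorLength (g ^ n) : ℕ∞) : ℝ≥0∞) / (n : ℝ≥0∞)) atTop

end StableCommutatorLength

/-! ### Groups acting on simplicial trees -/

namespace SimplicialTree

/-- The group `G`, which acts on the vertex set `V`, acts on the graph `T` by automorphisms and
without inversions: no element exchanges the endpoints of an edge. -/
structure ActsWithoutInversions (G : Type*) [Group G] {V : Type*} [MulAction G V]
    (T : SimpleGraph V) : Prop where
  adj_smul : ∀ (g : G) (u v : V), T.Adj u v → T.Adj (g • u) (g • v)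
  not_inversion : ∀ (g : G) (u v : V), T.Adj u v → ¬ (g • u = v ∧ g • v = u)

variable {G : Type*} [Group G] {V : Type*} [MulAction G V]

/-- The translation length `|g|`: the minimal displacement of a vertex. (For an action on a tree
without inversions, the minimal displacement over all points of the tree is attained at a
vertex.) -/
noncomputable def translationLength (T : SimpleGraph V) (g : G) : ℕ :=
  ⨅ v : V, T.dist v (g • v)

/-- The vertices of the characteristic subtree `T_g`: those of minimal displacement. The edges of
`T_g` are the edges of `T` that have both endpoints in this set. -/
def charSubtree (T : SimpleGraph V) (g : G) : Set V :=
  {v : V | T.dist v (g • v) = translationLength T g}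

/-- `g` is hyperbolic if its translation length is not zero; `charSubtree T g` is then the set of
vertices of the axis of `g`. -/
def IsHyperbolic (T : SimpleGraph V) (g : G) : Prop :=
  translationLength T g ≠ 0

/-- `g` is well-aligned: it is hyperbolic, and there is no `h` in `G` such that `g h g h⁻¹` fixes
an edge of the axis of `g`. -/
def IsWellAligned (T : SimpleGraph V) (g : G) : Prop :=
  IsHyperbolic T g ∧
    ¬ ∃ h : G, ∃ u v : V, T.Adj u v ∧ u ∈ charSubtree T g ∧ v ∈ charSubtree T g ∧
      (g * h * g * h⁻¹) • u = u ∧ (g * h * g * h⁻¹) • v = v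

end SimplicialTree

/-! ### Groups acting on real trees -/

namespace RealTree

/-- An `ℝ`-tree: a geodesic metric space that is `0`-hyperbolic (four-point condition). -/
structure IsRealTree (X : Type*) [MetricSpace X] : Prop where
  geodesic : ∀ x y : X, ∃ c : ℝ → X, c 0 = x ∧ c (dist x y) = y ∧
    ∀ s ∈ Icc 0 (dist x y), ∀ t ∈ Icc 0 (dist x y), dist (c s) (c t) = |s - t|
  four_point : ∀ x y z w : X,
    dist x y + dist z w ≤ max (dist x z + dist y w) (dist x w + dist y z)

/-- A nondegenerate segment: a subset isometric to an interval `[0, ℓ]` with `0 < ℓ`. -/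
def IsNondegenerateSegment {X : Type*} [MetricSpace X] (S : Set X) : Prop :=
  ∃ (ℓ : ℝ) (c : ℝ → X), 0 < ℓ ∧
    (∀ s ∈ Icc 0 ℓ, ∀ t ∈ Icc 0 ℓ, dist (c s) (c t) = |s - t|) ∧ S = c '' Icc 0 ℓ

variable {G : Type*} [Group G] (X : Type*) [MetricSpace X] [MulAction G X]

/-- The translation length `|g|`: the infimum of the displacement function `x ↦ d (x, g x)`. -/
noncomputable def translationLength (g : G) : ℝ :=
  ⨅ x : X, dist x (g • x)

/-- The characteristic subtree `T_g`: the points of minimal displacement. -/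
def charSubtree (g : G) : Set X :=
  {x : X | dist x (g • x) = translationLength X g}

/-- `g` is hyperbolic if its translation length is positive; `charSubtree X g` is then the axis
of `g`. -/
def IsHyperbolic (g : G) : Prop :=
  0 < translationLength X g

/-- `g` is well-aligned: it is hyperbolic, and there is no `h` in `G` such that `g h g h⁻¹` fixes
(pointwise) a nondegenerate segment of the axis of `g`. -/
def IsWellAligned (g : G) : Prop :=
  IsHyperbolic X g ∧
    ¬ ∃ h : G, ∃ S : Set X, IsNondegenerateSegment S ∧ S ⊆ charSubtree X g ∧
      ∀ x ∈ S, (g * h * g * h⁻¹) • x = x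

end RealTree

/-! The proof builds a Brooks-type counting quasimorphism. Let g translate its axis by L and let x
lie on the axis. A segment lying, with the right orientation, along a translate of the axis gets as
weight the largest integer strictly below length/L (0 for a point); every other segment gets weight
0. Maximizing the total weight over subdivisions gives a count c(u, v), and f(k) = c(x, kx) - c(kx,
x).

Cutting a segment in two lowers c by 0 or 1 (`maxChainSum_add_le`, `maxChainSum_le_add`), so
splitting the tripod x, ax, abx at its centre shows that f has defect at most 3.

Along the axis c(x, gⁿx) ≥ n - 1. The reverse count vanishes: a piece of positive weight would be an
overlap longer than L of the axis with an oppositely oriented translate by h. There hgh⁻¹ and g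
shift by L in opposite directions, so ghgh⁻¹ fixes two distinct points of the axis
(`OnAxis.fixed_of_reverse`), contrary to well-alignment. Hence f(gⁿ) ≥ n - 1, and the easy half of
Bavard duality gives scl(g) ≥ 1/(4·3).

Simplicial trees and real trees are treated together through `IsTreeLike`. They differ only in the
verification of these axioms, in the existence of the axis, and in passing from two fixed points to
a fixed edge or segment. -/

/-! ### Betweenness in tree-like metric spaces -/

section Between

variable {X : Type*} [MetricSpace X]

/-- `b` lies on the segment from `a` to `c`. -/
def Between (a b c : X) : Prop :=
  dist a b + dist b c = dist a c

theorem Between.symm {a b c : X} (h : Between a b c) : Between c b a := by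
  unfold Between at *
  rw [dist_comm c b, dist_comm b a, dist_comm c a]
  linarith

theorem between_left (a b : X) : Between a a b := by simp [Between]

theorem between_right (a b : X) : Between a b b := by simp [Between]

theorem Between.trans_left {a b c d : X} (h : Between a c d) (h' : Between a b c) :
    Between a b d ∧ Between b c d := by
  unfold Between at *
  have h₁ := dist_triangle a b d
  have h₂ := dist_triangle b c d
  constructor <;> linarith

theorem Between.trans_right {a b c d : X} (h : Between a b d) (h' : Between b c d) :
    Between a c d ∧ Between a b c := by
  obtain ⟨h₁, h₂⟩ := h.symm.trans_left h'.symm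
  exact ⟨h₁.symm, h₂.symm⟩

theorem Between.smul {G : Type*} [Group G] [MulAction G X] [IsIsometricSMul G X] {a b c : X}
    (h : Between a b c) (g : G) : Between (g • a) (g • b) (g • c) := by
  simpa [Between, dist_smul] using h

theorem Between.of_smul {G : Type*} [Group G] [MulAction G X] [IsIsometricSMul G X] {a b c : X}
    {g : G} (h : Between (g • a) (g • b) (g • c)) : Between a b c := by
  simpa [Between, dist_smul] using h

/-- Segments are totally ordered and any three points have a median, as in the vertex set of a
tree or in an `ℝ`-tree. -/
structure IsTreeLike (X : Type*) [MetricSpace X] : Prop where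
  linear : ∀ a b p q : X, Between a p b → Between a q b → Between a q p ∨ Between p q b
  median : ∀ a b c : X, ∃ m, Between a m b ∧ Between b m c ∧ Between a m c

namespace IsTreeLike

variable (hX : IsTreeLike X)
include hX

theorem between_of_dist_le {a b p q : X} (hp : Between a p b) (hq : Between a q b)
    (h : dist a p ≤ dist a q) : Between a p q := by
  rcases hX.linear a b q p hq hp with h' | h'
  · exact h'
  · have h₁ := (hq.trans_right h').2
    unfold Between at *
    have : dist q p = 0 := by linarith [dist_nonneg (x := q) (y := p)]
    rw [dist_eq_zero] at this
    subst this
    simp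

theorem eq_of_dist_eq {a b p q : X} (hp : Between a p b) (hq : Between a q b)
    (h : dist a p = dist a q) : p = q := by
  have := hX.between_of_dist_le hp hq h.le
  unfold Between at this
  rw [← dist_eq_zero]
  linarith

theorem between_append {a b c d : X} (h : Between a b c) (h' : Between b c d) (hbc : b ≠ c) :
    Between a b d ∧ Between a c d := by
  have hpos := dist_pos.2 hbc
  suffices Between a c d from ⟨(this.trans_left h).1, this⟩
  obtain ⟨m, h₁, h₂, h₃⟩ := hX.median a c d
  rcases hX.linear a c b m h h₁ with hm | hm
  · have h₄ := (h.trans_left hm).2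
    have h₅ := (h₂.trans_left h₄.symm).1
    unfold Between at h' h₅
    rw [dist_comm c b] at h₅
    linarith
  · have h₄ := (h'.trans_left hm).1
    have : m = c := by
      unfold Between at h₂ h₄ h' hm
      rw [← dist_eq_zero]
      linarith [dist_comm m c]
    exact this ▸ h₃

end IsTreeLike

end Between

/-! ### The axis of a hyperbolic isometry -/

section Axis

variable {X : Type*} [MetricSpace X] {G : Type*} [Group G] [MulAction G X] [IsIsometricSMul G X]

/-- `x` lies on an axis along which `g` translates by `L`. -/
def OnAxis (g : G) (L : ℝ) (x : X) : Prop :=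
  ∀ n : ℕ, dist x (g ^ n • x) = n * L

/-- Local to global: no backtracking at gx means none at any gᵏx, and consecutive steps overlap in a
segment of length L > 0, so `between_append` extends the geodesic indefinitely. -/
theorem IsTreeLike.onAxis_of_dist_sq (hX : IsTreeLike X) {g : G} {x : X} {L : ℝ} (hL : 0 < L)
    (h₁ : dist x (g • x) = L) (h₂ : dist x (g ^ 2 • x) = 2 * L) : OnAxis g L x := by
  have key : ∀ n : ℕ, dist x (g ^ n • x) = n * L ∧ dist x (g ^ (n + 1) • x) = (n + 1) * L := by
    intro n
    induction n with
    | zero => simp [h₁]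
    | succ n ih =>
      refine ⟨by push_cast; exact ih.2, ?_⟩
      have e : ∀ k, dist (g ^ k • x) (g ^ (k + 1) • x) = L := fun k => by
        rw [pow_succ, mul_smul, dist_smul, h₁]
      have h₃ : Between x (g ^ n • x) (g ^ (n + 1) • x) := by
        unfold Between; rw [ih.1, ih.2, e]; ring
      have h₄ : Between (g ^ n • x) (g ^ (n + 1) • x) (g ^ (n + 2) • x) := by
        unfold Between
        rw [e, e, pow_add, mul_smul, dist_smul, h₂]; ring
      have hne : g ^ n • x ≠ g ^ (n + 1) • x := by
        rw [← dist_pos, e]; exact hL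
      have h₅ := (hX.between_append h₃ h₄ hne).2
      unfold Between at h₅
      rw [ih.2, e] at h₅
      rw [show n + 1 + 1 = n + 2 from rfl, ← h₅]
      push_cast; ring
  exact fun n => (key n).1

/-- Either `g` has an axis, or the two halves of the segment from `g • y` to `y` and to `g ^ 2 • y`
agree. -/
theorem IsTreeLike.onAxis_or (hX : IsTreeLike X) (g : G) (y : X) :
    (∃ (L : ℝ) (x : X), 0 < L ∧ OnAxis g L x) ∨
      ∃ m, Between y m (g • y) ∧ Between (g • y) m (g ^ 2 • y) ∧
        dist y (g • y) ≤ 2 * dist m (g • y) := by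
  obtain ⟨m, h₁, h₂, h₃⟩ := hX.median y (g • y) (g ^ 2 • y)
  by_cases hD : dist y (g • y) ≤ 2 * dist m (g • y)
  · exact Or.inr ⟨m, h₁, h₂, hD⟩
  left
  push Not at hD
  have e : g ^ 2 • y = g • g • y := by rw [pow_two, mul_smul]
  have hgm : Between (g • y) (g • m) (g ^ 2 • y) := e ▸ h₁.smul g
  -- The overlap of [y, gy] and [gy, g²y] is less than half of each, so q = g⁻¹m precedes m on [y,
  -- gy]. Then q, gq = m, g²q lie in this order on [y, g²y].
  obtain ⟨q, hq⟩ : ∃ q, g • q = m := ⟨g⁻¹ • m, by simp⟩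
  have hqy : Between y q (g • y) := by
    rw [e, ← hq] at h₂
    exact h₂.of_smul
  have d₁ : dist y q = dist m (g • y) := by
    rw [← dist_smul g y q, hq, dist_comm]
  have d₂ : dist (g • y) (g • m) = dist y m := dist_smul ..
  have hlen := h₁
  unfold Between at hlen
  have o₁ : Between y q m := hX.between_of_dist_le hqy h₁ (by linarith)
  have o₂ : Between (g • y) m (g • m) :=
    hX.between_of_dist_le h₂ hgm (by rw [dist_comm (g • y) m]; linarith)
  have o₃ : Between m (g • m) (g ^ 2 • y) := (hgm.trans_left o₂).2
  have o₄ := (h₃.trans_right o₃).2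
  have o₅ := (o₄.trans_left o₁).2
  have d₃ : dist q m = dist y (g • y) - 2 * dist m (g • y) := by
    unfold Between at o₁
    linarith
  have d₄ : dist m (g • m) = dist q m := by
    conv_lhs => rw [← hq]
    rw [dist_smul, hq]
  refine ⟨dist q m, q, by linarith, hX.onAxis_of_dist_sq (by linarith) (by rw [hq]) ?_⟩
  rw [pow_two, mul_smul, hq]
  unfold Between at o₅
  linarith

theorem OnAxis.dist_pow_add {g : G} {L : ℝ} {x : X} (hx : OnAxis g L x) (m n : ℕ) :
    dist (g ^ m • x) (g ^ (m + n) • x) = n * L := by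
  rw [pow_add, mul_smul, dist_smul, hx n]

theorem OnAxis.between_pow {g : G} {L : ℝ} {x : X} (hx : OnAxis g L x) (m n : ℕ) :
    Between x (g ^ m • x) (g ^ (m + n) • x) := by
  unfold Between
  rw [hx, hx, hx.dist_pow_add]
  push_cast; ring

theorem OnAxis.le_dist_smul {g : G} {L : ℝ} {x : X} (hx : OnAxis g L x) (z : X) :
    L ≤ dist z (g • z) := by
  have h₁ : ∀ n : ℕ, dist z (g ^ n • z) ≤ n * dist z (g • z) := by
    intro n
    induction n with
    | zero => simp
    | succ n ih =>
      have := dist_triangle z (g ^ n • z) (g ^ (n + 1) • z)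
      rw [pow_succ, mul_smul, dist_smul, ← mul_smul, ← pow_succ] at this
      push_cast
      linarith
  by_contra! h
  -- The orbits of x and z stay at distance d(x, z), so nL ≤ 2 d(x, z) + n d(z, gz); this fails for
  -- n large if d(z, gz) < L.
  obtain ⟨n, hn⟩ := exists_nat_gt (2 * dist x z / (L - dist z (g • z)))
  rw [div_lt_iff₀ (by linarith)] at hn
  have h₂ := dist_triangle x z (g ^ n • x)
  have h₃ := dist_triangle z (g ^ n • z) (g ^ n • x)
  rw [dist_smul, dist_comm z x] at h₃
  rw [hx n] at h₂
  nlinarith [h₁ n]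

/-- `g` moves the points of its axis forward by `L`. -/
theorem OnAxis.smul_between (hX : IsTreeLike X) {g : G} {L : ℝ} {x : X} (hx : OnAxis g L x)
    {a b : X} {n : ℕ} (ha : Between x a (g ^ n • x)) (hb : Between a b (g ^ n • x))
    (hab : L ≤ dist a b) : Between a (g • a) b ∧ dist a (g • a) = L := by
  have hL : 0 ≤ L := by
    have := hx 1
    simp only [Nat.cast_one, one_mul] at this
    rw [← this]; exact dist_nonneg
  have e : g • g ^ n • x = g ^ (n + 1) • x := by rw [pow_succ', mul_smul]
  have e₁ : dist x (g • x) = L := by simpa using hx 1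
  have h₀ := hx.between_pow n 1
  have ha' : Between x a (g ^ (n + 1) • x) := (h₀.trans_left ha).1
  have hb' : Between x b (g ^ (n + 1) • x) := (h₀.trans_left (ha.trans_right hb).1).1
  have hga : Between (g • x) (g • a) (g ^ (n + 1) • x) := e ▸ ha.smul g
  have h₁ : Between x (g • x) (g ^ (n + 1) • x) := by
    have := hx.between_pow 1 n
    rwa [pow_one, add_comm] at this
  obtain ⟨hga', h₂⟩ := h₁.trans_right hga
  have d : dist x (g • a) = L + dist x a := by
    unfold Between at h₂
    rw [← h₂, dist_smul, e₁]
  have o₁ := hX.between_of_dist_le ha' hga' (by linarith)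
  have hab' := (ha.trans_right hb).2
  have o₂ := hX.between_of_dist_le hga' hb' (by
    unfold Between at hab'
    linarith)
  refine ⟨(o₂.trans_left o₁).2, ?_⟩
  unfold Between at o₁
  linarith

theorem OnAxis.smul_eq (hX : IsTreeLike X) {g : G} {L : ℝ} {x : X} (hx : OnAxis g L x)
    {a b : X} {n : ℕ} (ha : Between x a (g ^ n • x)) (hb : Between a b (g ^ n • x))
    (hab : dist a b = L) : g • a = b := by
  obtain ⟨h₁, h₂⟩ := hx.smul_between hX ha hb hab.ge
  exact hX.eq_of_dist_eq h₁ (between_right a b) (by rw [h₂, hab])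

/-- Two overlapping translates of the axis with opposite orientations, when the overlap is longer
than `L`: then `g * h * g * h⁻¹` fixes two distinct points of the axis. -/
theorem OnAxis.fixed_of_reverse (hX : IsTreeLike X) {g h : G} {L : ℝ} {x : X} (hx : OnAxis g L x)
    {a b : X} {m n : ℕ} (hb : Between x b (g ^ n • x)) (ha : Between b a (g ^ n • x))
    (ha' : Between (h • x) a (h • g ^ m • x)) (hb' : Between a b (h • g ^ m • x))
    (hab : L < dist a b) :
    ∃ u v, u ≠ v ∧ Between x u (g ^ n • x) ∧ Between x v (g ^ n • x) ∧
      (g * h * g * h⁻¹) • u = u ∧ (g * h * g * h⁻¹) • v = v := by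
  have ha₁ : Between x (h⁻¹ • a) (g ^ m • x) := by simpa using ha'.smul h⁻¹
  have hb₁ : Between (h⁻¹ • a) (h⁻¹ • b) (g ^ m • x) := by simpa using hb'.smul h⁻¹
  obtain ⟨h₁, h₂⟩ := hx.smul_between hX hb ha (by rw [dist_comm]; exact hab.le)
  obtain ⟨h₃, h₄⟩ := hx.smul_between hX ha₁ hb₁ (by rw [dist_smul]; exact hab.le)
  have hk : Between a (h • g • h⁻¹ • a) b := by simpa using h₃.smul h
  have hk' : dist a (h • g • h⁻¹ • a) = L := by
    rw [← h₄, ← dist_smul h (h⁻¹ • a), smul_inv_smul]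
  have hgb : dist (g • b) b = L := by rw [dist_comm, h₂]
  -- The conjugate hgh⁻¹ moves a by L towards b, and g moves it back. The second fixed point is gb,
  -- which hgh⁻¹ sends to b.
  have f₁ : g • h • g • h⁻¹ • a = a := by
    have := ha.trans_left hk.symm
    exact hx.smul_eq hX (hb.trans_right this.1).1 this.2 (by rw [dist_comm, hk'])
  have f₂ : g • h⁻¹ • g • b = h⁻¹ • b := by
    have := hb₁.trans_left (h₁.symm.smul h⁻¹)
    exact hx.smul_eq hX (ha₁.trans_right this.1).1 this.2 (by rw [dist_smul, hgb])
  refine ⟨a, g • b, ?_, (hb.trans_right ha).1,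
    (hb.trans_right (ha.trans_left h₁).1).1, by simpa [mul_smul] using f₁, ?_⟩
  · rintro rfl
    rw [dist_comm, h₂] at hab
    exact lt_irrefl _ hab
  · simp only [mul_smul]
    rw [f₂, smul_inv_smul]

end Axis

/-! ### Counting functions on segments -/

section Counting

variable {X : Type*} [MetricSpace X]

/-- `ChainSum W u v n`: there is a subdivision of the segment from `u` to `v` such that the sum of
the weights `W` of its pieces is `n`. -/
inductive ChainSum (W : X → X → ℕ) : X → X → ℕ → Prop
  | single (u v : X) : ChainSum W u v (W u v)
  | cons {u p v : X} {n : ℕ} (h : Between u p v) (hn : ChainSum W p v n) :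
      ChainSum W u v (W u p + n)

/-- The maximal sum of weights of a subdivision of the segment from `u` to `v`. -/
noncomputable def maxChainSum (W : X → X → ℕ) (u v : X) : ℕ :=
  sSup {n | ChainSum W u v n}

/-- A weight on segments that is bounded by a multiple of the length and changes by at most one if
a segment is cut in two. -/
structure IsWeight (W : X → X → ℕ) (L : ℝ) : Prop where
  pos : 0 < L
  mul_le : ∀ u v, W u v * L ≤ dist u v
  cut : ∀ u q v, Between u q v → W u v ≤ W u q + W q v + 1

variable {W : X → X → ℕ} {L : ℝ}

theorem ChainSum.mul_le (hW : IsWeight W L) {u v : X} {n : ℕ} (h : ChainSum W u v n) :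
    n * L ≤ dist u v := by
  induction h with
  | single u v => exact hW.mul_le u v
  | @cons u p v n h _ ih =>
    have := hW.mul_le u p
    unfold Between at h
    push_cast
    linarith

theorem ChainSum.append {u q v : X} {m n : ℕ} (h : ChainSum W u q m) (h' : ChainSum W q v n)
    (hq : Between u q v) : ChainSum W u v (m + n) := by
  induction h with
  | single u q => exact .cons hq h'
  | @cons u p q m hp _ ih =>
    obtain ⟨h₁, h₂⟩ := hq.trans_left hp
    rw [add_assoc]
    exact .cons h₁ (ih h' h₂)

/-- Only the piece containing q is cut, so the loss of 1 allowed by `IsWeight.cut` occurs once,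
however many pieces there are. -/
theorem ChainSum.split (hX : IsTreeLike X) (hW : IsWeight W L) {u v q : X} {n : ℕ}
    (h : ChainSum W u v n) (hq : Between u q v) :
    ∃ a b, ChainSum W u q a ∧ ChainSum W q v b ∧ n ≤ a + b + 1 := by
  induction h with
  | single u v => exact ⟨_, _, .single u q, .single q v, hW.cut _ _ _ hq⟩
  | @cons u p v n hp hn ih =>
    rcases hX.linear _ _ _ _ hp hq with h | h
    · refine ⟨_, _, .single u q, .cons (hp.trans_left h).2 hn, ?_⟩
      have := hW.cut _ _ _ h
      omega
    · obtain ⟨a, b, ha, hb, hab⟩ := ih h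
      exact ⟨_, b, .cons (hp.trans_right h).2 ha, hb, by omega⟩

theorem ChainSum.le_max (hW : IsWeight W L) {u v : X} {n : ℕ} (h : ChainSum W u v n) :
    n ≤ maxChainSum W u v := by
  refine le_csSup ⟨⌈dist u v / L⌉₊, ?_⟩ h
  intro k hk
  have := hk.mul_le hW
  rw [← le_div_iff₀ hW.pos] at this
  exact_mod_cast this.trans (Nat.le_ceil _)

theorem chainSum_max (hW : IsWeight W L) (u v : X) : ChainSum W u v (maxChainSum W u v) :=
  Nat.sSup_mem (s := {n | ChainSum W u v n}) ⟨_, .single u v⟩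
    ⟨maxChainSum W u v, fun _ h => h.le_max hW⟩

theorem maxChainSum_add_le (hW : IsWeight W L) {u q v : X} (hq : Between u q v) :
    maxChainSum W u q + maxChainSum W q v ≤ maxChainSum W u v :=
  ((chainSum_max hW u q).append (chainSum_max hW q v) hq).le_max hW

theorem maxChainSum_le_add (hX : IsTreeLike X) (hW : IsWeight W L) {u q v : X}
    (hq : Between u q v) :
    maxChainSum W u v ≤ maxChainSum W u q + maxChainSum W q v + 1 := by
  obtain ⟨a, b, ha, hb, h⟩ := (chainSum_max hW u v).split hX hW hq
  have := ha.le_max hW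
  have := hb.le_max hW
  omega

section Invariance

variable {G : Type*} [Group G] [MulAction G X] [IsIsometricSMul G X]

theorem ChainSum.smul (hG : ∀ (g : G) u v, W (g • u) (g • v) = W u v) {u v : X} {n : ℕ}
    (h : ChainSum W u v n) (g : G) : ChainSum W (g • u) (g • v) n := by
  induction h with
  | single u v => rw [← hG g]; exact .single _ _
  | cons h _ ih => rw [← hG g]; exact .cons (h.smul g) ih

theorem maxChainSum_smul (hG : ∀ (g : G) u v, W (g • u) (g • v) = W u v) (g : G) (u v : X) :
    maxChainSum W (g • u) (g • v) = maxChainSum W u v := by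
  unfold maxChainSum
  congr 1
  ext n
  exact ⟨fun h => by simpa using h.smul hG g⁻¹, fun h => h.smul hG g⟩

/-- The counting function of the segment from `x` to `g • x`, made antisymmetric. -/
noncomputable def countingFunction (W : X → X → ℕ) (x : X) (g : G) : ℤ :=
  maxChainSum W x (g • x) - maxChainSum W (g • x) x

theorem countingFunction_inv (hG : ∀ (g : G) u v, W (g • u) (g • v) = W u v) (x : X) (g : G) :
    countingFunction W x g⁻¹ = -countingFunction W x g := by
  unfold countingFunction
  rw [← maxChainSum_smul hG g x (g⁻¹ • x), ← maxChainSum_smul hG g (g⁻¹ • x) x, smul_inv_smul]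
  ring

/-- The contributions of the three legs of the tripod cancel. Each side has a cutting error in {0,
1} in either direction, so an antisymmetrized error in [-1, 1]; the three sides give 3. -/
theorem abs_countingFunction_mul_sub_le (hX : IsTreeLike X) (hW : IsWeight W L)
    (hG : ∀ (g : G) u v, W (g • u) (g • v) = W u v) (x : X) (a b : G) :
    |countingFunction W x (a * b) - countingFunction W x a - countingFunction W x b| ≤ 3 := by
  obtain ⟨m, h₁, h₂, h₃⟩ := hX.median x (a • x) ((a * b) • x)
  unfold countingFunction
  rw [← maxChainSum_smul hG a x (b • x), ← maxChainSum_smul hG a (b • x) x, ← mul_smul]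
  have l₁ := maxChainSum_add_le hW h₁
  have l₂ := maxChainSum_add_le hW h₂
  have l₃ := maxChainSum_add_le hW h₃
  have l₄ := maxChainSum_add_le hW h₁.symm
  have l₅ := maxChainSum_add_le hW h₂.symm
  have l₆ := maxChainSum_add_le hW h₃.symm
  have u₁ := maxChainSum_le_add hX hW h₁
  have u₂ := maxChainSum_le_add hX hW h₂
  have u₃ := maxChainSum_le_add hX hW h₃
  have u₄ := maxChainSum_le_add hX hW h₁.symm
  have u₅ := maxChainSum_le_add hX hW h₂.symm
  have u₆ := maxChainSum_le_add hX hW h₃.symm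
  rw [abs_le]
  constructor <;> omega

end Invariance

end Counting

/-! ### Quasimorphisms and stable commutator length -/

section Quasimorphism

variable {G : Type*} [Group G]

theorem abs_quasimorphism_commutator_le {f : G → ℤ} {D : ℤ}
    (hf : ∀ a b, |f (a * b) - f a - f b| ≤ D) (hinv : ∀ a, f a⁻¹ = -f a) {c : G}
    (hc : c ∈ commutatorSet G) : |f c| ≤ 3 * D := by
  obtain ⟨a, b, rfl⟩ := hc
  have h₁ := hf a b
  have h₂ := hf (a * b) a⁻¹
  have h₃ := hf (a * b * a⁻¹) b⁻¹
  rw [hinv] at h₂ h₃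
  rw [commutatorElement_def]
  rw [abs_le] at *
  constructor <;> linarith

/-- Each of the l commutators contributes 3D, and the l - 1 products joining them contribute D each.
-/
theorem abs_quasimorphism_prod_le {f : G → ℤ} {D : ℤ}
    (hf : ∀ a b, |f (a * b) - f a - f b| ≤ D) (hinv : ∀ a, f a⁻¹ = -f a) {l : List G}
    (hl : ∀ x ∈ l, x ∈ commutatorSet G) (hne : l ≠ []) : |f l.prod| ≤ (4 * l.length - 1) * D := by
  induction l with
  | nil => exact absurd rfl hne
  | cons c l ih =>
    have h₁ := abs_quasimorphism_commutator_le hf hinv (hl c (by simp))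
    by_cases hl' : l = []
    · subst hl'
      simpa using h₁
    have h₂ := ih (fun x hx => hl x (by simp [hx])) hl'
    have h₃ := hf c l.prod
    rw [List.prod_cons, List.length_cons]
    push_cast
    rw [abs_le] at *
    constructor <;> linarith

theorem le_mul_commutatorLength {g : G} {n d : ℕ} (hd : d ≠ 0)
    (h : ∀ l : List G, (∀ x ∈ l, x ∈ commutatorSet G) → l.prod = g → n ≤ d * l.length) :
    (n : ℕ∞) ≤ d * commutatorLength g := by
  unfold commutatorLength
  rcases Set.eq_empty_or_nonempty {n : ℕ∞ | ∃ l : List G, (∀ x ∈ l, x ∈ commutatorSet G) ∧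
      l.prod = g ∧ (l.length : ℕ∞) = n} with h₀ | h₀
  · rw [h₀, sInf_empty, ENat.mul_top (by exact_mod_cast hd)]
    exact le_top
  · obtain ⟨l, h₁, h₂, h₃⟩ := csInf_mem h₀
    rw [← h₃]
    exact_mod_cast h l h₁ h₂

/-- The easy half of Bavard duality, without homogenization. -/
theorem inv_le_scl_of_quasimorphism {f : G → ℤ} {D : ℕ} (hD : D ≠ 0)
    (hf : ∀ a b, |f (a * b) - f a - f b| ≤ D) (hinv : ∀ a, f a⁻¹ = -f a) {g : G}
    (hg : ∀ n : ℕ, (n : ℤ) - 1 ≤ f (g ^ n)) : 1 / ((4 * D : ℕ) : ℝ≥0∞) ≤ scl g := by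
  refine le_liminf_of_le (by isBoundedDefault) ?_
  -- For n ≥ 2 the list is nonempty, since f(1) = 0 by antisymmetry while f(gⁿ) ≥ 1. Then n - 1 ≤
  -- (4l - 1)D ≤ 4Dl - 1, so the bound holds term by term, without homogenization.
  filter_upwards [eventually_ge_atTop 2] with n hn
  have key : (n : ℕ∞) ≤ (4 * D : ℕ) * commutatorLength (g ^ n) := by
    refine le_mul_commutatorLength (by positivity) fun l hl hprod => ?_
    have h₁ := hg n
    have hne : l ≠ [] := by
      rintro rfl
      have h₂ := hinv 1
      rw [← hprod] at h₁
      simp only [List.prod_nil, inv_one] at h₁ h₂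
      omega
    have h₂ := (abs_le.1 (abs_quasimorphism_prod_le hf hinv hl hne)).2
    rw [hprod] at h₂
    have h₃ : (1 : ℤ) ≤ D := by exact_mod_cast Nat.one_le_iff_ne_zero.2 hD
    zify
    linarith
  have key' : (n : ℝ≥0∞) ≤ ((4 * D : ℕ) : ℝ≥0∞) * (commutatorLength (g ^ n) : ℕ∞) := by
    have := ENat.toENNReal_le.2 key
    simpa using this
  rw [ENNReal.le_div_iff_mul_le (Or.inl (by simp; omega)) (Or.inl (by simp)), one_div,
    ENNReal.inv_mul_le_iff (by simp [hD]) (ENNReal.natCast_ne_top _)]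
  exact key'

end Quasimorphism

/-! ### Counting translates of an axis -/

section AxisWeight

variable {X : Type*} [MetricSpace X] {G : Type*} [Group G] [MulAction G X]

/-- The segment from `a` to `b` is contained, with the same orientation, in a translate of the
axis of `g` through `x`. -/
def InAxisTranslate (g : G) (x a b : X) : Prop :=
  ∃ (h : G) (n : ℕ), Between (h • x) a (h • g ^ n • x) ∧ Between a b (h • g ^ n • x)

open Classical in
/-- The number of translates of a fundamental domain of length `L` that fit into the segment from
`a` to `b` with some room to spare, if this segment is in a translate of the axis. -/
noncomputable def axisWeight (g : G) (L : ℝ) (x a b : X) : ℕ :=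
  if InAxisTranslate g x a b then ⌈dist a b / L⌉₊ - 1 else 0

variable {g : G} {L : ℝ} {x : X}

theorem InAxisTranslate.cut {a q b : X} (hab : InAxisTranslate g x a b) (hq : Between a q b) :
    InAxisTranslate g x a q ∧ InAxisTranslate g x q b := by
  obtain ⟨h, n, h₁, h₂⟩ := hab
  obtain ⟨h₃, h₄⟩ := h₂.trans_left hq
  exact ⟨⟨h, n, h₁, h₃⟩, ⟨h, n, (h₁.trans_right h₃).1, h₄⟩⟩

theorem isWeight_axisWeight (hL : 0 < L) : IsWeight (axisWeight g L x) L where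
  pos := hL
  mul_le a b := by
    unfold axisWeight
    split_ifs
    · rw [← le_div_iff₀ hL]
      have h₀ : 0 ≤ dist a b / L := by positivity
      have := Nat.ceil_lt_add_one h₀
      rcases Nat.eq_zero_or_pos ⌈dist a b / L⌉₊ with h | h
      · simpa [h] using h₀
      · rw [Nat.cast_sub h, Nat.cast_one]
        linarith
    · simp
  cut a q b hq := by
    unfold axisWeight
    split_ifs with h h₁ h₂ h₂
    · have := Nat.ceil_add_le (dist a q / L) (dist q b / L)
      rw [← add_div, hq] at this
      omega
    · exact absurd (h.cut hq).2 h₂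
    · exact absurd (h.cut hq).1 h₁
    · exact absurd (h.cut hq).1 h₁
    all_goals omega

theorem OnAxis.axisWeight_pow (hL : 0 < L) (hx : OnAxis g L x) (n : ℕ) :
    axisWeight g L x x (g ^ n • x) = n - 1 := by
  have : InAxisTranslate g x x (g ^ n • x) :=
    ⟨1, n, by simpa using between_left _ _, by simpa using between_right _ _⟩
  rw [axisWeight, if_pos this, hx, mul_div_cancel_right₀ _ hL.ne', Nat.ceil_natCast]

variable [IsIsometricSMul G X]

theorem InAxisTranslate.smul {a b : X} (hab : InAxisTranslate g x a b) (k : G) :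
    InAxisTranslate g x (k • a) (k • b) := by
  obtain ⟨h, n, h₁, h₂⟩ := hab
  exact ⟨k * h, n, by simpa [mul_smul] using h₁.smul k, by simpa [mul_smul] using h₂.smul k⟩

theorem inAxisTranslate_smul (k : G) (a b : X) :
    InAxisTranslate g x (k • a) (k • b) ↔ InAxisTranslate g x a b :=
  ⟨fun h => by simpa using h.smul k⁻¹, fun h => h.smul k⟩

theorem axisWeight_smul (k : G) (a b : X) :
    axisWeight g L x (k • a) (k • b) = axisWeight g L x a b := by
  have := inAxisTranslate_smul (g := g) (x := x) k a b
  unfold axisWeight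
  split_ifs <;> simp_all [dist_smul]

/-- `g` is well-aligned: no `g * h * g * h⁻¹` fixes two distinct points of the axis. -/
def WellAlignedAt (g : G) (x : X) : Prop :=
  ∀ (h : G) (n : ℕ) (u v : X), Between x u (g ^ n • x) → Between x v (g ^ n • x) →
    (g * h * g * h⁻¹) • u = u → (g * h * g * h⁻¹) • v = v → u = v

/-- Well-alignment only excludes overlaps longer than L; at length exactly L the fixed points found
may coincide. Rounding strictly below length/L makes the weight 0 there too. -/
theorem OnAxis.axisWeight_reverse (hX : IsTreeLike X) (hL : 0 < L) (hx : OnAxis g L x)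
    (hg : WellAlignedAt g x) {n : ℕ} {a b : X} (ha : Between (g ^ n • x) a x)
    (hb : Between a b x) : axisWeight g L x a b = 0 := by
  unfold axisWeight
  split_ifs with h
  · have : dist a b ≤ L := by
      by_contra! hlt
      obtain ⟨k, m, h₁, h₂⟩ := h
      obtain ⟨hb', hab⟩ := ha.trans_right hb
      obtain ⟨u, v, huv, hu, hv, fu, fv⟩ :=
        hx.fixed_of_reverse hX hb'.symm hab.symm h₁ h₂ hlt
      exact huv (hg k n u v hu hv fu fv)
    have h₁ : ⌈dist a b / L⌉₊ ≤ 1 := by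
      rw [Nat.ceil_le, Nat.cast_one, div_le_one hL]
      exact this
    omega
  · rfl

theorem OnAxis.chainSum_reverse (hX : IsTreeLike X) (hL : 0 < L) (hx : OnAxis g L x)
    (hg : WellAlignedAt g x) {n k : ℕ} {a b : X} (h : ChainSum (axisWeight g L x) a b k)
    (ha : Between (g ^ n • x) a x) (hb : Between a b x) : k = 0 := by
  induction h with
  | single a b => exact hx.axisWeight_reverse hX hL hg ha hb
  | @cons a p b k hp _ ih =>
    obtain ⟨h₁, h₂⟩ := hb.trans_left hp
    rw [hx.axisWeight_reverse hX hL hg ha h₁, ih (ha.trans_right h₁).1 h₂]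

theorem OnAxis.le_countingFunction (hX : IsTreeLike X) (hL : 0 < L) (hx : OnAxis g L x)
    (hg : WellAlignedAt g x) (n : ℕ) :
    (n : ℤ) - 1 ≤ countingFunction (axisWeight g L x) x (g ^ n) := by
  have hW : IsWeight (axisWeight g L x) L := isWeight_axisWeight hL
  have h₁ := (ChainSum.single (W := axisWeight g L x) x (g ^ n • x)).le_max hW
  have h₂ := hx.chainSum_reverse hX hL hg (chainSum_max hW (g ^ n • x) x)
    (between_left _ _) (between_right _ _)
  rw [hx.axisWeight_pow hL] at h₁
  unfold countingFunction
  omega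

theorem OnAxis.le_scl (hX : IsTreeLike X) (hL : 0 < L) (hx : OnAxis g L x)
    (hg : WellAlignedAt g x) : 1 / 12 ≤ scl g := by
  have hW : IsWeight (axisWeight g L x) L := isWeight_axisWeight hL
  have := inv_le_scl_of_quasimorphism (D := 3) (by norm_num)
    (abs_countingFunction_mul_sub_le hX hW axisWeight_smul x)
    (countingFunction_inv axisWeight_smul x) (hx.le_countingFunction hX hL hg)
  norm_num at this ⊢
  exact this

end AxisWeight

/-! ### Fixed segments -/

section FixedSegment

variable {X : Type*} [MetricSpace X] {G : Type*} [Group G] [MulAction G X] [IsIsometricSMul G X]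

theorem IsTreeLike.between_convex (hX : IsTreeLike X) {a b u v w : X} (hu : Between a u b)
    (hv : Between a v b) (hw : Between u w v) : Between a w b := by
  rcases le_total (dist a u) (dist a v) with h | h
  · exact (hv.trans_left ((hX.between_of_dist_le hu hv h).trans_right hw).1).1
  · exact (hu.trans_left ((hX.between_of_dist_le hv hu h).trans_right hw.symm).1).1

theorem IsTreeLike.smul_eq_self (hX : IsTreeLike X) {k : G} {u v w : X} (hu : k • u = u)
    (hv : k • v = v) (hw : Between u w v) : k • w = w := by
  have h := hw.smul k
  rw [hu, hv] at h
  refine hX.eq_of_dist_eq h hw ?_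
  conv_lhs => rw [← hu]
  exact dist_smul ..

theorem OnAxis.dist_smul_eq (hX : IsTreeLike X) {g : G} {L : ℝ} {x : X} (hx : OnAxis g L x)
    {u : X} {n : ℕ} (hu : Between x u (g ^ n • x)) : dist u (g • u) = L := by
  obtain ⟨h₁, h₂⟩ := (hx.between_pow n 1).trans_left hu
  refine (hx.smul_between hX h₁ (between_right _ _) ?_).2
  have h₃ := hx.dist_pow_add n 1
  unfold Between at h₂
  rw [Nat.cast_one, one_mul] at h₃
  linarith [dist_nonneg (x := u) (y := g ^ n • x)]

/-- An isometry fixing two points fixes the segment between them. The hypothesis is thus phrased by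
segments, from which either an edge or a real segment can be extracted. -/
theorem OnAxis.wellAlignedAt (hX : IsTreeLike X) {g : G} {L : ℝ} {x : X} (hx : OnAxis g L x)
    (H : ∀ (h : G) (u v : X), u ≠ v → ¬ ∀ w, Between u w v →
      dist w (g • w) = L ∧ (g * h * g * h⁻¹) • w = w) : WellAlignedAt g x := by
  intro h n u v hu hv fu fv
  by_contra huv
  exact H h u v huv fun w hw =>
    ⟨hx.dist_smul_eq hX (hX.between_convex hu hv hw), hX.smul_eq_self fu fv hw⟩

/-- If the segments from `g • y` to `y` and to `g ^ 2 • y` agree up to `m`, then `g` acts on the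
middle part of the segment from `y` to `g • y` by the reflection. -/
theorem IsTreeLike.smul_eq_of_fold (hX : IsTreeLike X) {g : G} {y m p q : X}
    (hm : Between y m (g • y)) (hm' : Between (g • y) m (g ^ 2 • y)) (hp : Between y p (g • y))
    (hq : Between y q (g • y)) (hpq : dist y p = dist q (g • y))
    (hle : dist q (g • y) ≤ dist m (g • y)) : g • p = q := by
  have hgp : Between (g • y) (g • p) (g ^ 2 • y) := by
    rw [pow_two, mul_smul]
    exact hp.smul g
  rw [dist_comm q, dist_comm m] at hle
  rw [dist_comm q] at hpq
  have d : dist (g • y) (g • p) = dist (g • y) q := by rw [dist_smul, hpq]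
  exact hX.eq_of_dist_eq (hX.between_of_dist_le hgp hm' (d ▸ hle))
    (hX.between_of_dist_le hq.symm hm.symm hle) d

end FixedSegment

/-! ### `ℝ`-trees -/

namespace RealTree

variable {X : Type*} [MetricSpace X]

theorem IsRealTree.exists_between (hX : IsRealTree X) (a b : X) {t : ℝ} (h₀ : 0 ≤ t)
    (h₁ : t ≤ dist a b) : ∃ m, Between a m b ∧ dist a m = t := by
  obtain ⟨c, rfl, hb, hc⟩ := hX.geodesic a b
  have d₁ := hc 0 ⟨le_rfl, dist_nonneg⟩ t ⟨h₀, h₁⟩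
  have d₂ := hc t ⟨h₀, h₁⟩ _ ⟨dist_nonneg, le_rfl⟩
  rw [zero_sub, abs_neg, abs_of_nonneg h₀] at d₁
  rw [hb, abs_sub_comm, abs_of_nonneg (by linarith)] at d₂
  refine ⟨c t, ?_, d₁⟩
  unfold Between
  linarith

theorem IsRealTree.isTreeLike (hX : IsRealTree X) : IsTreeLike X where
  linear a b p q hp hq := by
    have h := hX.four_point a b p q
    unfold Between at *
    rw [dist_comm b q, dist_comm b p] at h
    have h₁ := dist_triangle a q p
    have h₂ := dist_triangle p q b
    rw [dist_comm q p] at h₁ ⊢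
    rcases le_max_iff.1 h with h | h
    · exact Or.inl (by linarith [dist_triangle a p q, dist_triangle q p b, dist_comm p q])
    · exact Or.inr (by linarith [dist_triangle a p q, dist_triangle q p b, dist_comm p q])
  median a b c := by
    have t₁ := dist_triangle a b c
    have t₂ := dist_triangle a c b
    have t₃ := dist_triangle b a c
    -- The median lies at distance from a equal to the Gromov product of b and c. The two terms of
    -- the four-point maximum are then equal and bound d(m, c).
    obtain ⟨m, hm, ht⟩ := hX.exists_between a b (t := (dist a b + dist a c - dist b c) / 2)
      (by rw [dist_comm b a] at t₃; linarith) (by rw [dist_comm c b] at t₂; linarith)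
    have h := hX.four_point m c a b
    refine ⟨m, hm, ?_⟩
    unfold Between at *
    have hmc : dist m c ≤ (dist a c + dist b c - dist a b) / 2 := by
      rw [dist_comm m a, dist_comm c b, dist_comm c a] at h
      rcases le_max_iff.1 h with h | h <;> linarith
    constructor
    · linarith [dist_triangle b m c, dist_comm m b]
    · linarith [dist_triangle a m c]

variable {G : Type*} [Group G] [MulAction G X]

theorem translationLength_le (g : G) (x : X) : translationLength X g ≤ dist x (g • x) :=
  ciInf_le ⟨0, by rintro _ ⟨y, rfl⟩; exact dist_nonneg⟩ x

variable [IsIsometricSMul G X]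

theorem IsRealTree.exists_onAxis (hX : IsRealTree X) {g : G} (hg : IsHyperbolic X g) :
    ∃ x : X, OnAxis g (translationLength X g) x := by
  -- The infimum of an empty real family is 0, so hyperbolicity excludes the empty space.
  have hne : Nonempty X := by
    by_contra h
    rw [not_nonempty_iff] at h
    simp [IsHyperbolic, translationLength, Real.iInf_of_isEmpty] at hg
  obtain ⟨y⟩ := id hne
  rcases hX.isTreeLike.onAxis_or g y with ⟨L, x, -, hx⟩ | ⟨m, h₁, h₂, h₃⟩
  · have : translationLength X g = L :=
      le_antisymm ((translationLength_le g x).trans (by simpa using (hx 1).le))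
        (le_ciInf hx.le_dist_smul)
    exact ⟨x, this ▸ hx⟩
  · have hy := dist_nonneg (x := y) (y := g • y)
    -- In the folded case g fixes the midpoint of [y, gy], contradicting positive translation
    -- length.
    obtain ⟨p, hp, hd⟩ := hX.exists_between y (g • y) (t := dist y (g • y) / 2)
      (by linarith) (by linarith)
    have hp' := hp
    unfold Between at hp'
    have := hX.isTreeLike.smul_eq_of_fold h₁ h₂ hp hp (by linarith) (by linarith)
    have h := translationLength_le g p
    rw [this, dist_self] at h
    exact absurd hg (not_lt.2 h)

theorem IsWellAligned.le_scl (hX : IsRealTree X) {g : G} (hg : IsWellAligned X g) :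
    1 / 12 ≤ scl g := by
  obtain ⟨hyp, hno⟩ := hg
  obtain ⟨x, hx⟩ := hX.exists_onAxis hyp
  refine hx.le_scl hX.isTreeLike hyp (hx.wellAlignedAt hX.isTreeLike fun h u v huv H => hno ?_)
  obtain ⟨c, hu, hv, hc⟩ := hX.geodesic u v
  have hb : ∀ w ∈ c '' Icc 0 (dist u v), Between u w v := by
    rintro _ ⟨t, ht, rfl⟩
    have d₁ := hc 0 ⟨le_rfl, dist_nonneg⟩ t ht
    have d₂ := hc t ht _ ⟨dist_nonneg, le_rfl⟩
    rw [hu, zero_sub, abs_neg, abs_of_nonneg ht.1] at d₁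
    rw [hv, abs_sub_comm, abs_of_nonneg (by linarith [ht.2])] at d₂
    unfold Between
    linarith
  exact ⟨h, _, ⟨dist u v, c, dist_pos.2 huv, hc, rfl⟩, fun w hw => (H w (hb w hw)).1,
    fun w hw => (H w (hb w hw)).2⟩

end RealTree

/-! ### Simplicial trees -/

namespace SimplicialTree

open SimpleGraph

variable {V : Type*} {T : SimpleGraph V}

/-- The path metric on the vertices of a connected graph. -/
noncomputable abbrev pathMetric (hT : T.Connected) : MetricSpace V where
  dist u v := T.dist u v
  dist_self u := by simp
  dist_comm u v := by rw [SimpleGraph.dist_comm]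
  dist_triangle u v w := by exact_mod_cast hT.dist_triangle
  eq_of_dist_eq_zero h := hT.dist_eq_zero_iff.1 (by exact_mod_cast h)

theorem exists_dist_eq (hT : T.Connected) {u v : V} {n : ℕ} (hn : n ≤ T.dist u v) :
    ∃ p, T.dist u p = n ∧ T.dist u p + T.dist p v = T.dist u v := by
  obtain ⟨w, hw⟩ := hT.exists_walk_length_eq_dist u v
  have h₁ := dist_le (w.take n)
  have h₂ := dist_le (w.drop n)
  have h₃ := hT.dist_triangle (u := u) (v := w.getVert n) (w := v)
  rw [Walk.take_length] at h₁
  rw [Walk.drop_length] at h₂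
  exact ⟨w.getVert n, by omega, by omega⟩

theorem length_eq_dist (hT : T.IsTree) {u v : V} {w : T.Walk u v} (hw : w.IsPath) :
    w.length = T.dist u v := by
  obtain ⟨w', hw', h⟩ := hT.connected.exists_path_of_dist u v
  rw [← h, (hT.existsUnique_path u v).unique hw hw']

theorem mem_support_iff (hT : T.IsTree) {u v p : V} {w : T.Walk u v} (hw : w.IsPath) :
    p ∈ w.support ↔ T.dist u p + T.dist p v = T.dist u v := by
  classical
  constructor
  · intro hp
    rw [← length_eq_dist hT (hw.takeUntil hp), ← length_eq_dist hT (hw.dropUntil hp),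
      ← length_eq_dist hT hw, ← Walk.length_append, Walk.take_spec]
  · intro h
    obtain ⟨w₁, h₁⟩ := hT.connected.exists_walk_length_eq_dist u p
    obtain ⟨w₂, h₂⟩ := hT.connected.exists_walk_length_eq_dist p v
    have := (w₁.append w₂).isPath_of_length_eq_dist (by rw [Walk.length_append, h₁, h₂, h])
    rw [(hT.existsUnique_path u v).unique hw this]
    simp

theorem isTreeLike (hT : T.IsTree) : @IsTreeLike V (pathMetric hT.connected) := by
  classical
  let _ := pathMetric hT.connected
  have hB : ∀ a b c : V, Between a b c ↔ T.dist a b + T.dist b c = T.dist a c := fun a b c =>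
    ⟨fun h => by exact_mod_cast (show (T.dist a b : ℝ) + T.dist b c = T.dist a c from h),
      fun h => show (T.dist a b : ℝ) + T.dist b c = T.dist a c by exact_mod_cast h⟩
  refine ⟨fun a b p q hp hq => ?_, fun a b c => ?_⟩
  · obtain ⟨w, hw, -⟩ := hT.connected.exists_path_of_dist a b
    rw [hB] at hp hq
    have hp' := (mem_support_iff hT hw).2 hp
    have hq' := (mem_support_iff hT hw).2 hq
    rw [← w.take_spec hp', Walk.mem_support_append_iff, mem_support_iff hT (hw.takeUntil hp'),
      mem_support_iff hT (hw.dropUntil hp')] at hq'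
    simpa only [hB] using hq'
  · obtain ⟨w, hw, -⟩ := hT.connected.exists_path_of_dist a b
    -- The median is the vertex of the path from a to b nearest to c. A path from m to c meets this
    -- path only in m, so the concatenations are paths, hence geodesic in a tree.
    obtain ⟨m, hm, hmin⟩ := w.support.toFinset.exists_min_image (fun v => T.dist v c)
      ⟨a, by simp⟩
    rw [List.mem_toFinset] at hm
    have key : ∀ (d : V) (s : T.Walk d m), s.IsPath → s.support ⊆ w.support →
        Between d m c := by
      intro d s hs hsub
      obtain ⟨r, hr, -⟩ := hT.connected.exists_path_of_dist m c
      have : (s.append r).IsPath := by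
        rw [Walk.isPath_def, Walk.support_append, List.nodup_append']
        refine ⟨hs.support_nodup, hr.support_nodup.tail, fun v hv hv' => ?_⟩
        have h₁ := hmin v (List.mem_toFinset.2 (hsub hv))
        have h₂ := (mem_support_iff hT hr).1 (List.mem_of_mem_tail hv')
        have h₃ : m = v := hT.connected.dist_eq_zero_iff.1 (by omega)
        subst h₃
        have h₄ := hr.support_nodup
        rw [← Walk.cons_tail_support, List.nodup_cons] at h₄
        exact h₄.1 hv'
      rw [hB]
      exact (mem_support_iff hT this).1 (by simp)
    refine ⟨m, (hB _ _ _).2 ((mem_support_iff hT hw).1 hm),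
      key b (w.dropUntil m hm).reverse (hw.dropUntil hm).reverse ?_,
      key a (w.takeUntil m hm) (hw.takeUntil hm) (w.support_takeUntil_subset_support hm)⟩
    rw [Walk.support_reverse]
    exact fun v hv => w.support_dropUntil_subset_support hm (List.mem_reverse.1 hv)

variable {G : Type*} [Group G] [MulAction G V]

theorem ActsWithoutInversions.dist_smul (hG : ActsWithoutInversions G T) (hT : T.Connected)
    (g : G) (u v : V) : T.dist (g • u) (g • v) = T.dist u v := by
  have h : ∀ (g : G) (u v : V), T.dist (g • u) (g • v) ≤ T.dist u v := by
    intro g u v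
    obtain ⟨w, hw⟩ := hT.exists_walk_length_eq_dist u v
    let φ : T →g T := ⟨fun v => g • v, fun h => hG.adj_smul g _ _ h⟩
    rw [← hw, ← w.length_map φ]
    exact dist_le _
  exact le_antisymm (h g u v) (by simpa using h g⁻¹ (g • u) (g • v))

theorem IsWellAligned.le_scl (hT : T.IsTree) (hG : ActsWithoutInversions G T) {g : G}
    (hg : IsWellAligned T g) : 1 / 12 ≤ scl g := by
  obtain ⟨hyp, hno⟩ := hg
  have hc := hT.connected
  have hX := isTreeLike hT
  let _ := pathMetric hc
  have hd : ∀ u v : V, dist u v = (T.dist u v : ℝ) := fun _ _ => rfl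
  have hB : ∀ a b c : V, T.dist a b + T.dist b c = T.dist a c → Between a b c := fun a b c h =>
    show (T.dist a b : ℝ) + T.dist b c = T.dist a c by exact_mod_cast h
  have : IsIsometricSMul G V := ⟨fun g => Isometry.of_dist_eq fun u v => by
    rw [hd, hd, hG.dist_smul hc]⟩
  have := hc.nonempty
  have hle : ∀ x : V, translationLength T g ≤ T.dist x (g • x) := fun x =>
    ciInf_le (OrderBot.bddBelow _) x
  obtain ⟨y⟩ := hc.nonempty
  rcases hX.onAxis_or g y with ⟨L, x, hL, hx⟩ | ⟨m, h₁, h₂, h₃⟩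
  · have hxL : (T.dist x (g • x) : ℝ) = L := by simpa [hd] using hx 1
    have htr : (translationLength T g : ℝ) = L := by
      rw [← hxL, Nat.cast_inj]
      refine le_antisymm (hle x) (le_ciInf fun z => ?_)
      have := hx.le_dist_smul z
      rw [← hxL, hd] at this
      exact_mod_cast this
    refine hx.le_scl hX hL (hx.wellAlignedAt hX fun h u v huv H => hno ?_)
    have hchar : ∀ w, Between u w v → w ∈ charSubtree T g := fun w hw => by
      have := (H w hw).1
      rw [← htr, hd] at this
      exact_mod_cast this
    obtain ⟨w, hw, hw'⟩ := exists_dist_eq hc (hc.pos_dist_of_ne huv)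
    have hw'' := hB _ _ _ hw'
    have hu := between_left u v
    exact ⟨h, u, w, dist_eq_one_iff_adj.1 hw, hchar u hu, hchar w hw'', (H u hu).2, (H w hw'').2⟩
  · exfalso
    have h₃' : T.dist y (g • y) ≤ 2 * T.dist m (g • y) := by
      rw [hd, hd] at h₃
      exact_mod_cast h₃
    -- Here p and q are at distances ⌊d/2⌋ and ⌈d/2⌉ from y, where d = d(y, gy), and the fold makes
    -- g exchange them; integrality gives d(m, gy) ≥ ⌈d/2⌉. So g fixes a vertex (d even) or inverts
    -- an edge (d odd).
    obtain ⟨p, hp, hp'⟩ := exists_dist_eq hc (u := y) (v := g • y)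
      (n := T.dist y (g • y) / 2) (by omega)
    obtain ⟨q, hq, hq'⟩ := exists_dist_eq hc (u := y) (v := g • y)
      (n := T.dist y (g • y) - T.dist y (g • y) / 2) (by omega)
    have hpB := hB _ _ _ hp'
    have hqB := hB _ _ _ hq'
    have hgp : g • p = q := hX.smul_eq_of_fold h₁ h₂ hpB hqB
      (by rw [hd, hd, Nat.cast_inj]; omega) (by rw [hd, hd, Nat.cast_le]; omega)
    have hgq : g • q = p := hX.smul_eq_of_fold h₁ h₂ hqB hpB
      (by rw [hd, hd, Nat.cast_inj]; omega) (by rw [hd, hd, Nat.cast_le]; omega)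
    have hpq : T.dist y p + T.dist p q = T.dist y q := by
      have := hX.between_of_dist_le hpB hqB (by rw [hd, hd, Nat.cast_le]; omega)
      unfold Between at this
      rw [hd, hd, hd] at this
      exact_mod_cast this
    have hfix := hle p
    rw [hgp] at hfix
    have hpos := Nat.pos_of_ne_zero hyp
    exact hG.not_inversion g p q (dist_eq_one_iff_adj.1 (by omega)) ⟨hgp, hgq⟩

end SimplicialTree

theorem mainTheorem3 {G : Type*} [Group G] (g : G) :
    (∀ {V : Type*} [MulAction G V] (T : SimpleGraph V), T.IsTree →
      SimplicialTree.ActsWithoutInversions G T →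
      SimplicialTree.IsWellAligned T g → 1 / 12 ≤ scl g) ∧
    (∀ {X : Type*} [MetricSpace X] [MulAction G X] [IsIsometricSMul G X],
      RealTree.IsRealTree X →
      RealTree.IsWellAligned X g → 1 / 12 ≤ scl g) :=
  ⟨fun _ hT hG hg => hg.le_scl hT hG, fun hX hg => hg.le_scl hX⟩
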